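/- Let $X_1, X_2, \ldots$ be independent identically distributed real random variables, let $X \stackrel{d}{=} X_1$, let $m, K$ be positive integers, and let $f_1,\ldots,f_m:\mathbb R\to\mathbb R$ be Borel functions with $\mathbb E[f_i^4(X)]<\infty$. Let $\mathcal Q := (\mathrm{Cov}(f_i(X),f_j(X)))_{i,j=1}^m$, $s(f_i):=\mathrm{Var}(f_i(X))^{1/2}$ and $\mathcal C := (\mathcal Q_{ij}/(s(f_i)s(f_j)))_{i,j=1}^m$ be the covariance and the correlation matrix of $(f_1(X),\ldots,f_m(X))$, and assume that $\mathcal Q$ is positive definite (then so is $\mathcal C$). For $N > k\ge 1$ put $$\hat m(f):=\frac1N\sum_{i=1}^N f(X_i),\qquad \hat s(f):=\Bigl(\frac1N\sum_{i=1}^N(f(X_i)-\hat m(f))^2\Bigr)^{1/2},$$ $$\hat\gamma_k(f,g):=\frac1{N-k}\sum_{i=1}^{N-k}(f(X_i)-\hat m(f))(g(X_{i+k})-\hat m(g)),\qquad \hat\rho_k(f,g):=\frac{\hat\gamma_k(f,g)}{\hat s(f)\hat s(g)},$$ with $\hat\rho_k(f,g):=0$ if $\hat s(f)\hat s(g)=0$,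 and let $\hat{\mathbb Q}_k:=[\hat\gamma_k(f_i,f_j)]_{i,j=1}^m$ and $\hat{\mathbb C}_k:=[\hat\rho_k(f_i,f_j)]_{i,j=1}^m$ be the resulting vectors in $\mathbb R^{m^2}$, with coordinates indexed by the pairs $(i,j)$. Let $\Phi$ be a continuous map from the symmetric positive definite $m\times m$-matrices to $\mathbb R^{m\times m}$ such that $\Phi(A)'\Phi(A)=A^{-1}$ for all $A$ (for example, $\Phi(A)=(A^{1/2})^{-1}$). Then, as $N\to\infty$, in distribution, $$N^{1/2}\cdot\Phi(\mathcal Q)\otimes\Phi(\mathcal Q)\,[\hat{\mathbb Q}_1,\ldots,\hat{\mathbb Q}_K]\Rightarrow\mathcal N_{m^2K}(\mathbf 0,I_{m^2K}),$$ $$N^{1/2}\cdot\Phi(\mathcal C)\otimes\Phi(\mathcal C)\,[\hat{\mathbb C}_1,\ldots,\hat{\mathbb C}_K]\Rightarrow\mathcal N_{m^2K}(\mathbf 0,I_{m^2K}),$$ where $\otimes$ is the Kronecker product and the $m^2\times m^2$-matrix $\Phi(\cdot)\otimes\Phi(\cdot)$ multiplies each of the $K$ vectors, the products being concatenated to one vector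 in $\mathbb R^{m^2K}$. -/

import Mathlib

open MeasureTheory ProbabilityTheory Filter Matrix
open scoped Kronecker

noncomputable section

namespace IIDTest

variable {Ω : Type*}

/-- Empirical mean of `f` over the first `N` observations. The observations
`X₁, X₂, …` are stored as `X 0, X 1, …`. -/
def empMean (X : ℕ → Ω → ℝ) (f : ℝ → ℝ) (N : ℕ) (ω : Ω) : ℝ :=
  (1 / (N : ℝ)) * ∑ i ∈ Finset.range N, f (X i ω)

/-- Empirical standard deviation of `f` over the first `N` observations. -/
def empStd (X : ℕ → Ω → ℝ) (f : ℝ → ℝ) (N : ℕ) (ω : Ω) : ℝ :=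
  Real.sqrt ((1 / (N : ℝ)) * ∑ i ∈ Finset.range N, (f (X i ω) - empMean X f N ω) ^ 2)

/-- Empirical cross-covariance of `f` and `g` with lag `k`, from the first `N` observations. -/
def empCov (X : ℕ → Ω → ℝ) (k : ℕ) (f g : ℝ → ℝ) (N : ℕ) (ω : Ω) : ℝ :=
  (1 / ((N : ℝ) - (k : ℝ))) * ∑ i ∈ Finset.range (N - k),
    (f (X i ω) - empMean X f N ω) * (g (X (i + k) ω) - empMean X g N ω)

/-- Empirical cross-correlation of `f` and `g` with lag `k`, from the first `N` observations. -/
def empCorr (X : ℕ → Ω → ℝ) (k : ℕ) (f g : ℝ → ℝ) (N : ℕ) (ω : Ω) : ℝ :=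
  empCov X k f g N ω / (empStd X f N ω * empStd X g N ω)

/-- The vector in `ℝ^(m²)` of the empirical covariances of `f i` and `f j` with lag `k`. -/
def empCovVec {m : ℕ} (X : ℕ → Ω → ℝ) (f : Fin m → ℝ → ℝ) (k N : ℕ) (ω : Ω) :
    Fin m × Fin m → ℝ :=
  fun p => empCov X k (f p.1) (f p.2) N ω

/-- The vector in `ℝ^(m²)` of the empirical correlations of `f i` and `f j` with lag `k`. -/
def empCorrVec {m : ℕ} (X : ℕ → Ω → ℝ) (f : Fin m → ℝ → ℝ) (k N : ℕ) (ω : Ω) :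
    Fin m × Fin m → ℝ :=
  fun p => empCorr X k (f p.1) (f p.2) N ω

/-- The covariance matrix of `(f₁(Y), …, fₘ(Y))`. -/
def covMat {m : ℕ} [MeasurableSpace Ω] (P : Measure Ω) (Y : Ω → ℝ) (f : Fin m → ℝ → ℝ) :
    Matrix (Fin m) (Fin m) ℝ :=
  Matrix.of fun i j => cov[fun ω => f i (Y ω), fun ω => f j (Y ω); P]

/-- The correlation matrix of `(f₁(Y), …, fₘ(Y))`. -/
def corrMat {m : ℕ} [MeasurableSpace Ω] (P : Measure Ω) (Y : Ω → ℝ) (f : Fin m → ℝ → ℝ) :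
    Matrix (Fin m) (Fin m) ℝ :=
  Matrix.of fun i j => cov[fun ω => f i (Y ω), fun ω => f j (Y ω); P] /
    (Real.sqrt Var[fun ω => f i (Y ω); P] * Real.sqrt Var[fun ω => f j (Y ω); P])

/-- `Φ` is a continuous whitening map on the symmetric positive definite `n × n` matrices:
`Φ(A)` is a square root of `A⁻¹`, in the sense `Φ(A)ᵀ Φ(A) = A⁻¹`, that is `Φ(A) A Φ(A)ᵀ = I`.
Values of `Φ` at other matrices are irrelevant. -/
structure IsWhiteningMap {n : ℕ} (Φ : Matrix (Fin n) (Fin n) ℝ → Matrix (Fin n) (Fin n) ℝ) :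
    Prop where
  continuousOn : ContinuousOn Φ {A | A.PosDef}
  transpose_mul_self : ∀ A : Matrix (Fin n) (Fin n) ℝ, A.PosDef → (Φ A)ᵀ * Φ A = A⁻¹

/-- The matrix `E` is applied to each of the vectors `v₁, …, v_K` in `ℝ^(m²)`, and the results are
concatenated to one vector in `ℝ^(m²K)`. -/
def blockMul {m K : ℕ} (E : Matrix (Fin m × Fin m) (Fin m × Fin m) ℝ)
    (v : Fin K → Fin m × Fin m → ℝ) : EuclideanSpace ℝ (Fin K × (Fin m × Fin m)) :=
  WithLp.toLp 2 fun p => (E *ᵥ v p.1) p.2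

end IIDTest

end

/-! Let `A` be `Φ` of the covariance matrix `Q`, so that `A Q Aᵀ = 1`, and let `g a` be the `a`-th
row of `A` applied to the centred functions `f j`. The `g a` are centred with identity covariance.
Empirical covariances are bilinear and ignore additive constants, so for `N ≠ 0` the vector `(A ⊗ A)
Q̂ₖ` is exactly the vector of empirical covariances of the pairs `(g a, g b)` (`empCov_linearComb`).

For whitened functions, `√N γ̂ₖ(g a, g b)` differs from `N^(-1/2) ∑_{i<N} g a (X i) g b (X (i+k))`
by `O(N^(-1/2))` in `L¹` (`hasL1Bound_remainder`). The lag is positive, so the two factors are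
independent, and the products are orthonormal over all times, lags and pairs
(`isOrthogonalFamily_prod`). Hence the limit covariance is the identity.

Characteristic functions reduce the joint limit to a linear combination of these products, which is
a function of a window of `K + 1` observations. Its partial sums are cut into blocks of length `L`
with gaps of length `K`. The block sums are i.i.d. and obey the classical central limit theorem,
while the gaps cost `O(1/L)` in mean square (`tendsto_integral_exp_of_blocks`).

For correlations, the same result is applied to the functions divided by their standard deviations.
The ratios of true to empirical standard deviations tend to 1 almost surely, and Slutsky's theorem
concludes. -/

section General

open Topology

variable {Ω : Type*} [MeasurableSpace Ω] {P : Measure Ω}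

namespace IIDTest

/-! ### Characteristic functions, orthogonal families and the big block method -/

lemma norm_exp_mul_I_sub_le (a b : ℝ) :
    ‖Complex.exp (a * Complex.I) - Complex.exp (b * Complex.I)‖ ≤ |a - b| := by
  have h : Complex.exp (a * Complex.I) - Complex.exp (b * Complex.I)
      = Complex.exp (b * Complex.I) * (Complex.exp (Complex.I * ((a - b : ℝ) : ℂ)) - 1) := by
    rw [mul_sub, ← Complex.exp_add, mul_one]
    congr 2
    push_cast; ring
  rw [h, norm_mul, Complex.norm_exp_ofReal_mul_I, one_mul]
  exact Real.norm_exp_I_mul_ofReal_sub_one_le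

lemma integrable_exp_mul_I [IsProbabilityMeasure P] {A : Ω → ℝ} (hA : AEMeasurable A P) :
    Integrable (fun ω => Complex.exp (A ω * Complex.I)) P := by
  refine Integrable.of_bound (C := 1) ?_ (ae_of_all _ fun ω => ?_)
  · exact AEMeasurable.aestronglyMeasurable (by fun_prop)
  · rw [Complex.norm_exp_ofReal_mul_I]

/-- Lets `L¹`-small perturbations be discarded inside characteristic functions; both the block
approximation and the centring remainder enter this way. -/
lemma norm_integral_exp_sub_le [IsProbabilityMeasure P] {A B : Ω → ℝ} (hA : AEMeasurable A P)
    (hB : AEMeasurable B P) (hAB : Integrable (fun ω => A ω - B ω) P) :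
    ‖∫ ω, Complex.exp (A ω * Complex.I) ∂P - ∫ ω, Complex.exp (B ω * Complex.I) ∂P‖
      ≤ ∫ ω, |A ω - B ω| ∂P := by
  rw [← integral_sub (integrable_exp_mul_I hA) (integrable_exp_mul_I hB)]
  refine (norm_integral_le_integral_norm _).trans (integral_mono_of_nonneg ?_ hAB.abs ?_)
  · exact ae_of_all _ fun ω => norm_nonneg _
  · exact ae_of_all _ fun ω => norm_exp_mul_I_sub_le _ _

lemma integral_abs_le_sqrt [IsProbabilityMeasure P] {A : Ω → ℝ} (hA : MemLp A 2 P) :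
    ∫ ω, |A ω| ∂P ≤ √(∫ ω, A ω ^ 2 ∂P) := by
  refine Real.le_sqrt_of_sq_le ?_
  have hA' : MemLp (fun ω => |A ω|) 2 P := hA.abs
  have h := variance_nonneg (fun ω => |A ω|) P
  rw [variance_eq_sub hA'] at h
  simpa using h

/-- A family of square integrable random variables which are pairwise orthogonal, with common second
moment `v`. -/
structure IsOrthogonalFamily {ι : Type*} [DecidableEq ι] (Y : ι → Ω → ℝ) (v : ℝ)
    (P : Measure Ω) : Prop where
  memLp : ∀ i, MemLp (Y i) 2 P
  integral_mul : ∀ i j, ∫ ω, Y i ω * Y j ω ∂P = if i = j then v else 0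

namespace IsOrthogonalFamily

variable {ι : Type*} [DecidableEq ι] {Y : ι → Ω → ℝ} {v : ℝ}

lemma memLp_sum (h : IsOrthogonalFamily Y v P) (S : Finset ι) :
    MemLp (fun ω => ∑ i ∈ S, Y i ω) 2 P := memLp_finsetSum S fun i _ => h.memLp i

lemma integral_sum_mul_sum (h : IsOrthogonalFamily Y v P) (S T : Finset ι) :
    ∫ ω, (∑ i ∈ S, Y i ω) * (∑ j ∈ T, Y j ω) ∂P = (S ∩ T).card * v := by
  have hint : ∀ i j, Integrable (fun ω => Y i ω * Y j ω) P := fun i j =>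
    (h.memLp i).integrable_mul (h.memLp j)
  simp_rw [Finset.sum_mul_sum]
  rw [integral_finsetSum _ fun i _ => integrable_finsetSum _ fun j _ => hint i j]
  simp_rw [integral_finsetSum _ fun j _ => hint _ j, h.integral_mul]
  simp [Finset.sum_ite_mem]

lemma integral_sum_sq (h : IsOrthogonalFamily Y v P) (S : Finset ι) :
    ∫ ω, (∑ i ∈ S, Y i ω) ^ 2 ∂P = S.card * v := by
  simp_rw [pow_two, h.integral_sum_mul_sum, Finset.inter_self]

end IsOrthogonalFamily

/-- The central limit theorem for characteristic functions, in the square integrable centred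
case. -/
lemma tendsto_integral_exp_inv_sqrt_mul_sum [IsProbabilityMeasure P] {B : ℕ → Ω → ℝ}
    (hB : MemLp (B 0) 2 P)
    (h0 : ∫ ω, B 0 ω ∂P = 0) {v : ℝ} (hv : ∫ ω, B 0 ω ^ 2 ∂P = v)
    (hind : iIndepFun B P) (hid : ∀ j, IdentDistrib (B j) (B 0) P P) (c : ℝ) :
    Tendsto (fun n : ℕ => ∫ ω, Complex.exp
      ((c * ((√n)⁻¹ * ∑ j ∈ Finset.range n, B j ω) : ℝ) * Complex.I) ∂P) atTop
      (𝓝 (Complex.exp ((-(c ^ 2 * v / 2) : ℝ) : ℂ))) := by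
  have hvar : Var[B 0; P] = v := by
    rw [variance_eq_sub hB, h0]; simpa using hv
  have hv0 : 0 ≤ v := hvar ▸ variance_nonneg _ _
  have h := tendstoInDistribution_inv_sqrt_mul_sum_sub (Y := id)
    (P' := gaussianReal 0 Var[B 0; P].toNNReal)
    (HasLaw.id) hB hind hid
  have h1 := ProbabilityMeasure.tendsto_iff_tendsto_charFun.1 h.tendsto c
  simp only [ProbabilityMeasure.coe_mk, Measure.map_id, charFun_gaussianReal] at h1
  refine Tendsto.congr (fun n => ?_) (h1.trans (le_of_eq ?_))
  · rw [charFun_apply_real, integral_map (h.forall_aemeasurable n)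
      (AEMeasurable.aestronglyMeasurable (by fun_prop))]
    simp [h0]
  · congr 2
    simp [hvar, hv0]
    ring

lemma blockIndex_injOn {L r : ℕ} (hr : r ≤ L) (M : ℕ) :
    Set.InjOn (fun p : ℕ × ℕ => p.1 * L + p.2)
      ((Finset.range M ×ˢ Finset.range r : Finset (ℕ × ℕ)) : Set (ℕ × ℕ)) := by
  rintro ⟨a, b⟩ h ⟨c, d⟩ h' heq
  simp only [Finset.coe_product, Finset.coe_range, Set.mem_prod, Set.mem_Iio] at h h' heq
  have hb : b < L := h.2.trans_le hr
  have hd : d < L := h'.2.trans_le hr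
  have h1 : a = c := by
    have := congrArg (· / L) heq
    simpa [Nat.mul_add_div, mul_comm _ L, Nat.zero_lt_of_lt hb, Nat.div_eq_of_lt hb,
      Nat.div_eq_of_lt hd] using this
  subst h1
  simp only [Nat.add_left_cancel_iff] at heq
  rw [heq]

/-- The indices below `M * L` whose residue modulo `L` is less than `r`. -/
def blockIndices (L r M : ℕ) : Finset ℕ :=
  (Finset.range M ×ˢ Finset.range r).image fun p => p.1 * L + p.2

lemma card_blockIndices {L r : ℕ} (hr : r ≤ L) (M : ℕ) : (blockIndices L r M).card = M * r := by
  rw [blockIndices, Finset.card_image_of_injOn (blockIndex_injOn hr M)]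
  simp

lemma sum_blockIndices {L r : ℕ} (hr : r ≤ L) (M : ℕ) (y : ℕ → ℝ) :
    ∑ n ∈ blockIndices L r M, y n = ∑ j ∈ Finset.range M, ∑ i ∈ Finset.range r, y (j * L + i) := by
  rw [blockIndices, Finset.sum_image (blockIndex_injOn hr M), Finset.sum_product]

lemma blockIndices_subset {L r : ℕ} (hr : r ≤ L) (N : ℕ) :
    blockIndices L r (N / L) ⊆ Finset.range N := by
  intro n hn
  simp only [blockIndices, Finset.mem_image, Finset.mem_product, Finset.mem_range, Prod.exists]
    at hn ⊢
  obtain ⟨a, b, ⟨ha, hb⟩, rfl⟩ := hn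
  calc a * L + b < a * L + L := by omega
    _ = (a + 1) * L := by ring
    _ ≤ N / L * L := Nat.mul_le_mul_right _ ha
    _ ≤ N := Nat.div_mul_le_self N L

/-- With `M = N / L`, the kept indices lie in `range N`, so by orthogonality the square expands to
`v (1 + (1 - K/L) - 2 M (L - K) / √(N L M))`. Now `M L ≤ N` gives `1/√(N L M) ≥ 1/N`, and `N - L ≤ M
L` bounds the cross term below by `(1 - K/L)(1 - L/N)`. Finally `L/N ≤ 1/L`, so the bound does not
depend on `N`. -/
lemma IsOrthogonalFamily.integral_sub_block_sq_le {Y : ℕ → Ω → ℝ} {v : ℝ}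
    (h : IsOrthogonalFamily Y v P) (hv : 0 ≤ v) {K L N : ℕ} (hKL : K < L) (hN : L ^ 2 ≤ N) :
    ∫ ω, ((√N)⁻¹ * ∑ i ∈ Finset.range N, Y i ω - (√L)⁻¹ * ((√(N / L : ℕ))⁻¹ *
      ∑ j ∈ Finset.range (N / L), ∑ i ∈ Finset.range (L - K), Y (j * L + i) ω)) ^ 2 ∂P
      ≤ v * ((K + 2) / L) := by
  set M := N / L with hM
  have hL0 : 0 < L := by omega
  have hLN : L ≤ N := by nlinarith
  have hN0 : 0 < N := by omega
  have hM0 : 0 < M := Nat.div_pos hLN hL0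
  set S := Finset.range N
  set B := blockIndices L (L - K) M
  have hBS : B ⊆ S := blockIndices_subset (Nat.sub_le _ _) N
  have hcard : (B.card : ℝ) = M * (L - K) := by
    rw [card_blockIndices (Nat.sub_le _ _)]
    push_cast [Nat.cast_sub hKL.le]; rfl
  set a := (√(N : ℝ))⁻¹
  set b := (√(L : ℝ))⁻¹ * (√(M : ℝ))⁻¹
  have hexp : ∀ ω, (a * ∑ i ∈ S, Y i ω - (√(L : ℝ))⁻¹ * ((√(M : ℝ))⁻¹ *
      ∑ j ∈ Finset.range M, ∑ i ∈ Finset.range (L - K), Y (j * L + i) ω)) ^ 2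
      = a ^ 2 * (∑ i ∈ S, Y i ω) ^ 2 + b ^ 2 * (∑ i ∈ B, Y i ω) ^ 2
        - 2 * a * b * ((∑ i ∈ S, Y i ω) * (∑ i ∈ B, Y i ω)) := fun ω => by
    rw [sum_blockIndices (Nat.sub_le _ _) M fun n => Y n ω]
    ring
  simp_rw [hexp]
  have i1 := (h.memLp_sum S).integrable_sq.const_mul (a ^ 2)
  have i2 := (h.memLp_sum B).integrable_sq.const_mul (b ^ 2)
  have i3 := ((h.memLp_sum S).integrable_mul (h.memLp_sum B)).const_mul (2 * a * b)
  have e := integral_sub (i1.add i2) i3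
  simp only [Pi.add_apply, Pi.mul_apply] at e
  rw [e, integral_add i1 i2, integral_const_mul, integral_const_mul, integral_const_mul,
    h.integral_sum_sq, h.integral_sum_sq, h.integral_sum_mul_sum,
    Finset.inter_eq_right.2 hBS, hcard]
  have hNr : (0 : ℝ) < N := by exact_mod_cast hN0
  have hMr : (0 : ℝ) < M := by exact_mod_cast hM0
  have hLr : (0 : ℝ) < L := by exact_mod_cast hL0
  have hKr : (K : ℝ) < L := by exact_mod_cast hKL
  have ha2 : a ^ 2 = (N : ℝ)⁻¹ := by simp [a, inv_pow]
  have hb2 : b ^ 2 = (L : ℝ)⁻¹ * (M : ℝ)⁻¹ := by simp [b, mul_pow, inv_pow]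
  have hbN : (M : ℝ) * L ≤ N := by exact_mod_cast Nat.div_mul_le_self N L
  have hab : (N : ℝ)⁻¹ ≤ a * b := by
    have ha : a = √((N : ℝ)⁻¹) := by simp [a]
    have hb : b = √(((L : ℝ) * M)⁻¹) := by simp [b, mul_comm]
    rw [ha, hb, ← Real.sqrt_mul (by positivity)]
    refine Real.le_sqrt_of_sq_le ?_
    rw [pow_two]
    gcongr
    linarith
  have hS : (S.card : ℝ) = N := by simp [S]
  rw [hS, ha2, hb2]
  have hMN : (N : ℝ) - L ≤ M * L := by
    have : N < M * L + L := by
      have := Nat.lt_div_mul_add (a := N) hL0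
      simpa [hM] using this
    have : (N : ℝ) < M * L + L := by exact_mod_cast this
    linarith
  have hlow : (1 - K / L) * (1 - L / N) ≤ a * b * (M * (L - K)) := by
    calc (1 - K / L : ℝ) * (1 - L / N) = (N : ℝ)⁻¹ * ((N - L) * (L - K) / L) := by field_simp
      _ ≤ (N : ℝ)⁻¹ * ((M * L) * (L - K) / L) := by
          gcongr
      _ = (N : ℝ)⁻¹ * (M * (L - K)) := by field_simp
      _ ≤ a * b * (M * (L - K)) := by
          gcongr
  have hLN' : (L : ℝ) / N ≤ 1 / L := by
    rw [div_le_div_iff₀ hNr hLr]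
    have : (L : ℝ) ^ 2 ≤ N := by exact_mod_cast hN
    nlinarith
  have hKL1 : (0 : ℝ) ≤ K / L := by positivity
  have hLN0 : (0 : ℝ) ≤ L / N := by positivity
  have key : 1 + (1 - K / L : ℝ) - 2 * (a * b * (M * (L - K))) ≤ (K + 2) / L := by
    have h2 : ((K : ℝ) + 2) / L = K / L + 2 * (1 / L) := by ring
    rw [h2]
    nlinarith [mul_nonneg hKL1 hLN0]
  calc _ = v * (1 + (1 - K / L : ℝ) - 2 * (a * b * (M * (L - K)))) := by field_simp
    _ ≤ _ := mul_le_mul_of_nonneg_left key hv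

/-- Central limit theorem by the big block method: an orthogonal centred sequence whose block
sums, with gaps of length `K` between consecutive blocks, are independent and identically
distributed, satisfies the central limit theorem. -/
theorem tendsto_integral_exp_of_blocks [IsProbabilityMeasure P] {Y : ℕ → Ω → ℝ} {v : ℝ}
    (h : IsOrthogonalFamily Y v P) (h0 : ∀ i, ∫ ω, Y i ω ∂P = 0) {K : ℕ}
    (hind : ∀ L, K < L →
      iIndepFun (fun (j : ℕ) ω => ∑ i ∈ Finset.range (L - K), Y (j * L + i) ω) P)
    (hid : ∀ L, K < L → ∀ j : ℕ,
      IdentDistrib (fun ω => ∑ i ∈ Finset.range (L - K), Y (j * L + i) ω)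
        (fun ω => ∑ i ∈ Finset.range (L - K), Y (0 * L + i) ω) P P) :
    Tendsto (fun N : ℕ => ∫ ω, Complex.exp
      (((√N)⁻¹ * ∑ i ∈ Finset.range N, Y i ω : ℝ) * Complex.I) ∂P) atTop
      (𝓝 (Complex.exp ((-(v / 2) : ℝ) : ℂ))) := by
  have hv : 0 ≤ v := by
    have := h.integral_mul 0 0
    simp only [if_true] at this
    rw [← this]
    exact integral_nonneg fun ω => mul_self_nonneg _
  have hm : ∀ S : Finset ℕ, MemLp (fun ω => ∑ i ∈ S, Y i ω) 2 P := h.memLp_sum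
  -- For fixed `L` a block sum has variance `(L - K) v`; the scaling `1/√L` turns it into `(1 - K/L)
  -- v`, which tends to `v` as `L` grows.
  have hblock : ∀ L, K < L → Tendsto (fun N : ℕ => ∫ ω, Complex.exp
      (((√L)⁻¹ * ((√(N / L : ℕ))⁻¹ * ∑ j ∈ Finset.range (N / L),
        ∑ i ∈ Finset.range (L - K), Y (j * L + i) ω) : ℝ) * Complex.I) ∂P) atTop
      (𝓝 (Complex.exp ((-((1 - K / L) * v / 2) : ℝ) : ℂ))) := by
    intro L hKL
    have hL0 : 0 < L := by omega
    have hB : MemLp (fun ω => ∑ i ∈ Finset.range (L - K), Y (0 * L + i) ω) 2 P := by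
      simpa using hm (Finset.range (L - K))
    have := tendsto_integral_exp_inv_sqrt_mul_sum hB ?_ (v := (L - K) * v) ?_ (hind L hKL)
      (hid L hKL) ((√L)⁻¹)
    · refine (this.comp (Nat.tendsto_div_const_atTop hL0.ne')).trans (le_of_eq ?_)
      congr 3
      have hLr : (0 : ℝ) < L := by exact_mod_cast hL0
      rw [inv_pow, Real.sq_sqrt hLr.le]
      field_simp
    · rw [integral_finsetSum _ fun i _ => (h.memLp _).integrable one_le_two]
      simp [h0]
    · have := h.integral_sum_sq (Finset.range (L - K))
      simpa [Nat.cast_sub hKL.le] using this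
  rw [Metric.tendsto_atTop]
  intro ε hε
  have hinv : Tendsto (fun L : ℕ => ((L : ℝ))⁻¹) atTop (𝓝 0) := tendsto_inv_atTop_nhds_zero_nat
  have t1 : Tendsto (fun L : ℕ => √(v * ((K + 2) / L))) atTop (𝓝 0) := by
    have : Tendsto (fun L : ℕ => √(v * ((K + 2) * (L : ℝ)⁻¹))) atTop (𝓝 √(v * ((K + 2) * 0))) :=
      ((hinv.const_mul _).const_mul _).sqrt
    simpa [div_eq_mul_inv] using this
  have t2 : Tendsto (fun L : ℕ => Complex.exp ((-((1 - K / L) * v / 2) : ℝ) : ℂ)) atTop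
      (𝓝 (Complex.exp ((-(v / 2) : ℝ) : ℂ))) := by
    have hc : Continuous fun x : ℝ => Complex.exp ((-((1 - K * x) * v / 2) : ℝ) : ℂ) := by fun_prop
    have := (hc.tendsto 0).comp hinv
    simpa [Function.comp_def, div_eq_mul_inv] using this
  have e1 := t1.eventually (gt_mem_nhds (show (0 : ℝ) < ε / 3 by positivity))
  have e2 := Metric.tendsto_atTop.1 t2 (ε / 3) (by positivity)
  obtain ⟨L0, hL0⟩ := e2
  obtain ⟨L, hL1, hL2, hL3⟩ :=
    (e1.and ((eventually_ge_atTop L0).and (eventually_gt_atTop K))).exists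
  -- `L` is fixed before `N`: the approximation error is uniform over `N ≥ L ^ 2`.
  obtain ⟨N0, hN0⟩ := Metric.tendsto_atTop.1 (hblock L hL3) (ε / 3) (by positivity)
  refine ⟨max N0 (L ^ 2), fun N hN => ?_⟩
  have hNL : L ^ 2 ≤ N := (le_max_right _ _).trans hN
  have hT : MemLp (fun ω => (√N)⁻¹ * ∑ i ∈ Finset.range N, Y i ω) 2 P := (hm _).const_mul _
  have hU : MemLp (fun ω => (√L)⁻¹ * ((√(N / L : ℕ))⁻¹ * ∑ j ∈ Finset.range (N / L),
        ∑ i ∈ Finset.range (L - K), Y (j * L + i) ω)) 2 P := by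
    refine MemLp.const_mul (MemLp.const_mul ?_ _) _
    exact memLp_finsetSum _ fun j _ => memLp_finsetSum _ fun i _ => h.memLp _
  have d1 := norm_integral_exp_sub_le hT.aestronglyMeasurable.aemeasurable
    hU.aestronglyMeasurable.aemeasurable ((hT.sub hU).integrable one_le_two)
  have d1' : _ ≤ √(v * ((K + 2) / L)) := (d1.trans (integral_abs_le_sqrt (hT.sub hU))).trans
    (Real.sqrt_le_sqrt (h.integral_sub_block_sq_le hv hL3 hNL))
  have d2 := hN0 N ((le_max_left _ _).trans hN)
  have d3 := hL0 L hL2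
  rw [← dist_eq_norm] at d1'
  calc _ ≤ _ := dist_triangle4 _ _ _ _
    _ < ε / 3 + ε / 3 + ε / 3 := add_lt_add (add_lt_add (d1'.trans_lt hL1) d2) d3
    _ = ε := by ring

end IIDTest

end General

/-! ### Moving windows of an i.i.d. sequence -/

section Window

open Topology

variable {Ω : Type*} [MeasurableSpace Ω] {P : Measure Ω} {X : ℕ → Ω → ℝ}

namespace IIDTest

lemma blockEmbedding_injective (L : ℕ) :
    Function.Injective (fun p : (_ : ℕ) × Fin L => p.1 * L + (p.2 : ℕ)) := by
  rintro ⟨a, b⟩ ⟨c, d⟩ h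
  have := blockIndex_injOn le_rfl (max a c + 1) (x₁ := (a, b.1)) (x₂ := (c, d.1))
    (by simp) (by simp) h
  simp only [Prod.mk.injEq] at this
  obtain ⟨rfl, h2⟩ := this
  rw [Fin.ext h2]

/-- The joint law is a product measure over `ℕ × Fin L`; currying makes it a product over `ℕ` of the
laws of the blocks. -/
lemma iIndepFun_blocks (hindep : iIndepFun X P) (hX : ∀ n, AEMeasurable (X n) P) (L : ℕ) :
    iIndepFun (fun (j : ℕ) ω (l : Fin L) => X (j * L + l) ω) P := by
  have := hindep.isProbabilityMeasure
  have hpre := hindep.precomp (blockEmbedding_injective L)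
  have hind (j : ℕ) : iIndepFun (fun (l : Fin L) ω => X (j * L + l) ω) P :=
    hindep.precomp (g := fun l : Fin L => j * L + (l : ℕ)) fun a b h => Fin.ext (by simpa using h)
  have hm (j : ℕ) : AEMeasurable (fun ω (l : Fin L) => X (j * L + l) ω) P :=
    aemeasurable_pi_lambda _ fun l => hX _
  have _ (n : ℕ) : IsProbabilityMeasure (P.map (X n)) := Measure.isProbabilityMeasure_map (hX n)
  rw [iIndepFun_iff_map_fun_eq_infinitePi_map₀' hm]
  have h1 := hpre.map_fun_eq_infinitePi_map₀' fun p => hX _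
  have h2 := congrArg (Measure.map (MeasurableEquiv.piCurry fun (_ : ℕ) (_ : Fin L) => ℝ)) h1
  rw [Measure.infinitePi_map_piCurry (fun (j : ℕ) (l : Fin L) => P.map (X (j * L + l))),
    AEMeasurable.map_map_of_aemeasurable (by fun_prop)
      (aemeasurable_pi_lambda _ fun p => hX _)] at h2
  refine Eq.trans (Eq.trans ?_ h2) ?_
  · rfl
  · congr 1
    funext j
    exact ((hind j).map_fun_eq_infinitePi_map₀' fun l => hX _).symm

lemma identDistrib_blocks (hindep : iIndepFun X P) (hident : ∀ n, IdentDistrib (X n) (X 0) P P)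
    (L j : ℕ) : IdentDistrib (fun ω (l : Fin L) => X (j * L + l) ω)
      (fun ω (l : Fin L) => X (0 * L + l) ω) P P := by
  have hind (j : ℕ) : iIndepFun (fun (l : Fin L) ω => X (j * L + l) ω) P :=
    hindep.precomp (g := fun l : Fin L => j * L + (l : ℕ)) fun a b h => Fin.ext (by simpa using h)
  exact IdentDistrib.pi (fun l => (hident _).trans (hident _).symm) (hind j) (hind 0)

/-- Central limit theorem for an orthogonal sequence of functions of moving windows of an
independent identically distributed sequence. -/
theorem tendsto_integral_exp_of_window (hindep : iIndepFun X P)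
    (hident : ∀ n, IdentDistrib (X n) (X 0) P P) {K : ℕ} {F : (Fin (K + 1) → ℝ) → ℝ}
    (hF : Measurable F) {v : ℝ}
    (h : IsOrthogonalFamily (fun (i : ℕ) ω => F fun r => X (i + r) ω) v P)
    (h0 : ∀ i : ℕ, ∫ ω, F (fun r => X (i + r) ω) ∂P = 0) :
    Tendsto (fun N : ℕ => ∫ ω, Complex.exp
      (((√N)⁻¹ * ∑ i ∈ Finset.range N, F (fun r => X (i + r) ω) : ℝ) * Complex.I) ∂P) atTop
      (𝓝 (Complex.exp ((-(v / 2) : ℝ) : ℂ))) := by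
  have := hindep.isProbabilityMeasure
  have hX n := (hident n).aemeasurable_fst
  -- A window starting at a position below `L - K` stays inside its block, so the default value 0 is
  -- never used. Block sums thus depend on disjoint blocks of observations.
  let G (L : ℕ) (x : Fin L → ℝ) : ℝ := ∑ i ∈ Finset.range (L - K),
    F fun r => if h : i + r < L then x ⟨i + r, h⟩ else 0
  have hG L : Measurable (G L) := by
    refine Finset.measurable_fun_sum _ fun i _ => hF.comp (measurable_pi_lambda _ fun r => ?_)
    split_ifs <;> fun_prop
  have hGX L (hL : K < L) (j : ℕ) : (fun ω => ∑ i ∈ Finset.range (L - K),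
      F fun r => X (j * L + i + r) ω) = G L ∘ fun ω (l : Fin L) => X (j * L + l) ω := by
    funext ω
    refine Finset.sum_congr rfl fun i hi => congrArg F (funext fun r => ?_)
    have hi' := Finset.mem_range.1 hi
    have : i + (r : ℕ) < L := by omega
    simp [this, add_assoc]
  refine tendsto_integral_exp_of_blocks h h0 (K := K) (fun L hL => ?_) (fun L hL j => ?_)
  · have := (iIndepFun_blocks hindep hX L).comp _ fun _ => hG L
    simp only [← hGX L hL] at this
    exact this
  · rw [hGX L hL, hGX L hL]
    exact (identDistrib_blocks hindep hident L j).comp (hG L)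

/-! ### Whitened functions and their lagged products -/

/-- The functions `g a` of the observations are centred, with identity covariance matrix. -/
structure IsWhitened {m : ℕ} (P : Measure Ω) (X : ℕ → Ω → ℝ) (g : Fin m → ℝ → ℝ) : Prop where
  measurable : ∀ a, Measurable (g a)
  memLp : ∀ a, MemLp (fun ω => g a (X 0 ω)) 2 P
  integral_eq_zero : ∀ a, ∫ ω, g a (X 0 ω) ∂P = 0
  integral_mul : ∀ a b, ∫ ω, g a (X 0 ω) * g b (X 0 ω) ∂P = if a = b then 1 else 0

lemma integral_mul_of_notMem (hindep : iIndepFun X P) (hX : ∀ n, AEMeasurable (X n) P)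
    {φ : ℝ → ℝ} (hφ : Measurable φ) {S : Finset ℕ} {ψ : (S → ℝ) → ℝ} (hψ : Measurable ψ) {n : ℕ}
    (hn : n ∉ S) :
    ∫ ω, φ (X n ω) * ψ (fun i => X i ω) ∂P
      = (∫ ω, φ (X n ω) ∂P) * ∫ ω, ψ (fun i => X i ω) ∂P := by
  have h := hindep.indepFun_finset₀ {n} S (by simpa using hn) hX
  have h' := h.comp (φ := fun x : ({n} : Finset ℕ) → ℝ => φ (x ⟨n, by simp⟩)) (ψ := ψ)
    (hφ.comp (measurable_pi_apply _)) hψ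
  exact h'.integral_fun_mul_eq_mul_integral
    (AEMeasurable.aestronglyMeasurable (hφ.comp_aemeasurable (hX n)))
    (AEMeasurable.aestronglyMeasurable
      (hψ.comp_aemeasurable (aemeasurable_pi_lambda _ fun i => hX i)))

/-- A centred factor whose time occurs only once is independent of the other three; the indices `i`,
`j`, `k` may coincide. -/
lemma integral_mul_eq_zero_of_ne (hindep : iIndepFun X P) (hX : ∀ n, AEMeasurable (X n) P)
    {φ φ₁ φ₂ φ₃ : ℝ → ℝ} (hφ : Measurable φ) (h₁ : Measurable φ₁) (h₂ : Measurable φ₂)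
    (h₃ : Measurable φ₃) {n i j k : ℕ} (h0 : ∫ ω, φ (X n ω) ∂P = 0) (hi : n ≠ i) (hj : n ≠ j)
    (hk : n ≠ k) :
    ∫ ω, φ (X n ω) * (φ₁ (X i ω) * φ₂ (X j ω) * φ₃ (X k ω)) ∂P = 0 := by
  have h := integral_mul_of_notMem hindep hX hφ (S := {i, j, k})
    (ψ := fun x => φ₁ (x ⟨i, by simp⟩) * φ₂ (x ⟨j, by simp⟩) * φ₃ (x ⟨k, by simp⟩))
    (by fun_prop) (n := n) (by simp [hi, hj, hk])
  rw [h0, zero_mul] at h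
  exact h

lemma integral_mul_of_ne (hindep : iIndepFun X P) (hX : ∀ n, AEMeasurable (X n) P)
    {φ ψ : ℝ → ℝ} (hφ : Measurable φ) (hψ : Measurable ψ) {i j : ℕ} (hij : i ≠ j) :
    ∫ ω, φ (X i ω) * ψ (X j ω) ∂P = (∫ ω, φ (X i ω) ∂P) * ∫ ω, ψ (X j ω) ∂P :=
  integral_mul_of_notMem hindep hX hφ (S := {j}) (ψ := fun x => ψ (x ⟨j, by simp⟩))
    (by fun_prop) (by simpa using hij)

namespace IsWhitened

variable {m : ℕ} {g : Fin m → ℝ → ℝ}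

lemma memLp' (hg : IsWhitened P X g) (hident : ∀ n, IdentDistrib (X n) (X 0) P P) (a : Fin m)
    (n : ℕ) : MemLp (fun ω => g a (X n ω)) 2 P :=
  ((hident n).comp (hg.measurable a)).memLp_iff.2 (hg.memLp a)

lemma integral_eq_zero' (hg : IsWhitened P X g) (hident : ∀ n, IdentDistrib (X n) (X 0) P P)
    (a : Fin m) (n : ℕ) : ∫ ω, g a (X n ω) ∂P = 0 :=
  ((hident n).comp (hg.measurable a)).integral_eq.trans (hg.integral_eq_zero a)

lemma integral_mul' (hg : IsWhitened P X g) (hident : ∀ n, IdentDistrib (X n) (X 0) P P)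
    (a b : Fin m) (n : ℕ) : ∫ ω, g a (X n ω) * g b (X n ω) ∂P = if a = b then 1 else 0 :=
  ((hident n).comp ((hg.measurable a).mul (hg.measurable b))).integral_eq.trans
    (hg.integral_mul a b)

lemma isOrthogonalFamily (hg : IsWhitened P X g) (hindep : iIndepFun X P)
    (hident : ∀ n, IdentDistrib (X n) (X 0) P P) (a : Fin m) :
    IsOrthogonalFamily (fun (n : ℕ) ω => g a (X n ω)) 1 P where
  memLp n := hg.memLp' hident a n
  integral_mul i j := by
    split_ifs with h
    · subst h
      simpa using hg.integral_mul' hident a a i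
    · rw [integral_mul_of_ne hindep (fun n => (hident n).aemeasurable_fst) (hg.measurable a)
        (hg.measurable a) h, hg.integral_eq_zero' hident, zero_mul]

/-- The products of whitened functions of two observations at positive lags form an orthonormal
family, indexed by the time, the lag (minus one) and the pair of functions. -/
lemma isOrthogonalFamily_prod (hg : IsWhitened P X g) (hindep : iIndepFun X P)
    (hident : ∀ n, IdentDistrib (X n) (X 0) P P) (K : ℕ) :
    IsOrthogonalFamily (fun (p : ℕ × (Fin K × (Fin m × Fin m))) ω =>
      g p.2.2.1 (X p.1 ω) * g p.2.2.2 (X (p.1 + (p.2.1 + 1)) ω)) 1 P where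
  memLp := by
    rintro ⟨i, k, a, b⟩
    -- Independence of the two factors makes the product of their squares integrable.
    have hind : IndepFun (fun ω => g a (X i ω)) (fun ω => g b (X (i + (k + 1)) ω)) P :=
      (hindep.indepFun (show i ≠ i + (k + 1) by omega)).comp (hg.measurable a) (hg.measurable b)
    have h1 := hg.memLp' hident a i
    have h2 := hg.memLp' hident b (i + (k + 1))
    refine (memLp_two_iff_integrable_sq (h1.aestronglyMeasurable.mul h2.aestronglyMeasurable)).2 ?_
    have := (hind.comp (measurable_id.pow_const 2) (measurable_id.pow_const 2)).integrable_mul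
      h1.integrable_sq h2.integrable_sq
    refine this.congr (ae_of_all _ fun ω => ?_)
    simp [mul_pow]
  integral_mul := by
    rintro ⟨i, k, a, b⟩ ⟨j, l, c, d⟩
    have hX n := (hident n).aemeasurable_fst
    have hm := hg.measurable
    have h0 := hg.integral_eq_zero' hident
    dsimp only
    by_cases h1 : i + ((k : ℕ) + 1) = j + (l + 1)
    -- When the later times agree, either the earlier ones agree too, and the moment factors into
    -- two Kronecker deltas, or time `i` occurs only once.
    · by_cases h2 : i = j
      · subst h2
        have hkl : k = l := Fin.ext (by omega)
        subst hkl
        calc _ = ∫ ω, (fun x => g a x * g c x) (X i ω) *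
              (fun x => g b x * g d x) (X (i + (k + 1)) ω) ∂P := by
              congr 1; funext ω; ring
          _ = _ := by
              rw [integral_mul_of_ne (φ := fun x => g a x * g c x) (ψ := fun x => g b x * g d x)
                hindep hX ((hm a).mul (hm c)) ((hm b).mul (hm d))
                (show i ≠ i + (k + 1) by omega), hg.integral_mul' hident, hg.integral_mul' hident]
              simp only [Prod.mk.injEq, true_and]
              split_ifs <;> simp_all
      · rw [if_neg (by simp [h2])]
        rw [← integral_mul_eq_zero_of_ne (n := i) (i := i + (k + 1)) (j := j) (k := j + (l + 1))
          hindep hX (hm a) (hm b) (hm c) (hm d) (h0 a i) (by omega) h2 (by omega)]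
        congr 1; funext ω; ring
    · have hne : ¬ ((i, k, a, b) = (j, l, c, d)) := by
        intro h
        simp only [Prod.mk.injEq] at h
        exact h1 (by rw [h.1, h.2.1])
      rw [if_neg hne]
      -- The larger of the two later times exceeds all the other times, so it occurs only once.
      rcases lt_or_gt_of_ne h1 with h2 | h2
      · rw [← integral_mul_eq_zero_of_ne (n := j + (l + 1)) (i := i) (j := i + (k + 1)) (k := j)
          hindep hX (hm d) (hm a) (hm b) (hm c) (h0 d _) (by omega) (by omega) (by omega)]
        congr 1; funext ω; ring
      · rw [← integral_mul_eq_zero_of_ne (n := i + (k + 1)) (i := i) (j := j + (l + 1)) (k := j)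
          hindep hX (hm b) (hm a) (hm d) (hm c) (h0 b _) (by omega) (by omega) (by omega)]
        congr 1; funext ω; ring

lemma integral_prod_eq_zero (hg : IsWhitened P X g) (hindep : iIndepFun X P)
    (hident : ∀ n, IdentDistrib (X n) (X 0) P P) (a b : Fin m) {i j : ℕ} (hij : i ≠ j) :
    ∫ ω, g a (X i ω) * g b (X j ω) ∂P = 0 := by
  rw [integral_mul_of_ne hindep (fun n => (hident n).aemeasurable_fst) (hg.measurable a)
    (hg.measurable b) hij, hg.integral_eq_zero' hident, zero_mul]

/-- Central limit theorem for linear combinations of lagged products of whitened functions. -/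
theorem tendsto_integral_exp (hg : IsWhitened P X g) (hindep : iIndepFun X P)
    (hident : ∀ n, IdentDistrib (X n) (X 0) P P) (K : ℕ) (t : Fin K × (Fin m × Fin m) → ℝ) :
    Tendsto (fun N : ℕ => ∫ ω, Complex.exp
      (((√N)⁻¹ * ∑ i ∈ Finset.range N, ∑ p, t p *
        (g p.2.1 (X i ω) * g p.2.2 (X (i + (p.1 + 1)) ω)) : ℝ) * Complex.I) ∂P) atTop
      (𝓝 (Complex.exp ((-((∑ p, t p ^ 2) / 2) : ℝ) : ℂ))) := by
  have hfam := hg.isOrthogonalFamily_prod hindep hident K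
  -- One window of `K + 1` observations contains all lags from 1 to `K`.
  let F (x : Fin (K + 1) → ℝ) : ℝ := ∑ p, t p * (g p.2.1 (x 0) * g p.2.2 (x p.1.succ))
  have hF : Measurable F := by
    have := hg.measurable
    refine Finset.measurable_fun_sum _ fun p _ => ?_
    exact (((this _).comp (measurable_pi_apply _)).mul
      ((this _).comp (measurable_pi_apply _))).const_mul _
  have hFX (i : ℕ) (ω : Ω) : F (fun r => X (i + r) ω) =
      ∑ p, t p * (g p.2.1 (X i ω) * g p.2.2 (X (i + (p.1 + 1)) ω)) := by
    simp [F]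
  have hmem (i : ℕ) (p : Fin K × (Fin m × Fin m)) := hfam.memLp (i, p)
  have key := tendsto_integral_exp_of_window hindep hident hF (v := ∑ p, t p ^ 2) ?_ ?_
  · simpa only [hFX] using key
  · constructor
    · intro i
      simp_rw [hFX]
      exact memLp_finsetSum _ fun p _ => (hmem i p).const_mul _
    · intro i j
      have hint (p q : Fin K × (Fin m × Fin m)) : Integrable (fun ω => (t p * t q) *
          ((g p.2.1 (X i ω) * g p.2.2 (X (i + (p.1 + 1)) ω)) *
            (g q.2.1 (X j ω) * g q.2.2 (X (j + (q.1 + 1)) ω)))) P :=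
        ((hmem i p).integrable_mul (hmem j q)).const_mul _
      have e (ω : Ω) : F (fun r => X (i + r) ω) * F (fun r => X (j + r) ω) = ∑ p, ∑ q,
          (t p * t q) * ((g p.2.1 (X i ω) * g p.2.2 (X (i + (p.1 + 1)) ω)) *
            (g q.2.1 (X j ω) * g q.2.2 (X (j + (q.1 + 1)) ω))) := by
        rw [hFX, hFX, Finset.sum_mul_sum]
        exact Finset.sum_congr rfl fun p _ => Finset.sum_congr rfl fun q _ => by ring
      simp_rw [e]
      rw [integral_finsetSum _ fun p _ => integrable_finsetSum _ fun q _ => hint p q]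
      simp_rw [integral_finsetSum _ fun q _ => hint _ q]
      have e2 (p q : Fin K × (Fin m × Fin m)) := hfam.integral_mul (i, p) (j, q)
      simp only at e2
      simp only [integral_const_mul, e2, Prod.mk.injEq]
      by_cases hij : i = j
      · simp [hij, pow_two]
      · simp [hij]
  · intro i
    simp_rw [hFX]
    have := hindep.isProbabilityMeasure
    rw [integral_finsetSum _ fun p _ => ((hmem i p).const_mul _).integrable one_le_two]
    refine Finset.sum_eq_zero fun p _ => ?_
    rw [integral_const_mul, hg.integral_prod_eq_zero hindep hident _ _ (by omega), mul_zero]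

end IsWhitened

end IIDTest

end Window

/-! ### Centring and truncation errors in `L¹` -/

section Remainder

open Topology

variable {Ω : Type*} [MeasurableSpace Ω] {P : Measure Ω} {X : ℕ → Ω → ℝ}

namespace IIDTest

lemma aemeasurable_empMean (hX : ∀ n, AEMeasurable (X n) P) {f : ℝ → ℝ} (hf : Measurable f)
    (N : ℕ) : AEMeasurable (empMean X f N) P :=
  (Finset.aemeasurable_fun_sum _ fun i _ => hf.comp_aemeasurable (hX i)).const_mul _

lemma aemeasurable_empStd (hX : ∀ n, AEMeasurable (X n) P) {f : ℝ → ℝ} (hf : Measurable f)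
    (N : ℕ) : AEMeasurable (empStd X f N) P :=
  ((Finset.aemeasurable_fun_sum _ fun i _ => ((hf.comp_aemeasurable (hX i)).sub
    (aemeasurable_empMean hX hf N)).pow_const 2).const_mul _).sqrt

lemma aemeasurable_empCov (hX : ∀ n, AEMeasurable (X n) P) {f g : ℝ → ℝ} (hf : Measurable f)
    (hg : Measurable g) (k N : ℕ) : AEMeasurable (empCov X k f g N) P :=
  (Finset.aemeasurable_fun_sum _ fun i _ => ((hf.comp_aemeasurable (hX i)).sub
    (aemeasurable_empMean hX hf N)).mul ((hg.comp_aemeasurable (hX (i + k))).sub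
    (aemeasurable_empMean hX hg N))).const_mul _

/-- `R` is integrable, with `L¹` norm at most `c`. -/
def HasL1Bound (P : Measure Ω) (R : Ω → ℝ) (c : ℝ) : Prop :=
  Integrable R P ∧ ∫ ω, |R ω| ∂P ≤ c

namespace HasL1Bound

variable {R S : Ω → ℝ} {c d : ℝ}

lemma mono (h : HasL1Bound P R c) (hcd : c ≤ d) : HasL1Bound P R d := ⟨h.1, h.2.trans hcd⟩

lemma add (hR : HasL1Bound P R c) (hS : HasL1Bound P S d) :
    HasL1Bound P (fun ω => R ω + S ω) (c + d) := by
  refine ⟨hR.1.add hS.1, ?_⟩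
  calc ∫ ω, |R ω + S ω| ∂P ≤ ∫ ω, (|R ω| + |S ω|) ∂P :=
        integral_mono (hR.1.add hS.1).abs (hR.1.abs.add hS.1.abs) fun ω => abs_add_le _ _
    _ = ∫ ω, |R ω| ∂P + ∫ ω, |S ω| ∂P := integral_add hR.1.abs hS.1.abs
    _ ≤ c + d := add_le_add hR.2 hS.2

lemma const_mul (hR : HasL1Bound P R c) (a : ℝ) : HasL1Bound P (fun ω => a * R ω) (|a| * c) := by
  refine ⟨hR.1.const_mul a, ?_⟩
  simp_rw [abs_mul]
  rw [integral_const_mul]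
  exact mul_le_mul_of_nonneg_left hR.2 (abs_nonneg a)

lemma sum {ι : Type*} {s : Finset ι} {R : ι → Ω → ℝ} {c : ι → ℝ}
    (h : ∀ i ∈ s, HasL1Bound P (R i) (c i)) :
    HasL1Bound P (fun ω => ∑ i ∈ s, R i ω) (∑ i ∈ s, c i) := by
  classical
  induction s using Finset.induction_on with
  | empty => simp [HasL1Bound]
  | insert a s ha ih =>
    simp_rw [Finset.sum_insert ha]
    exact (h a (by simp)).add (ih fun i hi => h i (by simp [hi]))

end HasL1Bound

namespace IsOrthogonalFamily

variable {ι κ : Type*} [DecidableEq ι] [DecidableEq κ]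

lemma comp_injective {Y : ι → Ω → ℝ} {v : ℝ} (h : IsOrthogonalFamily Y v P) {e : κ → ι}
    (he : Function.Injective e) : IsOrthogonalFamily (fun i => Y (e i)) v P where
  memLp i := h.memLp _
  integral_mul i j := by simp [h.integral_mul, he.eq_iff]

lemma hasL1Bound_sum [IsProbabilityMeasure P] {Y : ι → Ω → ℝ} (h : IsOrthogonalFamily Y 1 P)
    (S : Finset ι) : HasL1Bound P (fun ω => ∑ i ∈ S, Y i ω) (√S.card) := by
  refine ⟨(h.memLp_sum S).integrable one_le_two, (integral_abs_le_sqrt (h.memLp_sum S)).trans ?_⟩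
  rw [h.integral_sum_sq, mul_one]

/-- From `2|xy| ≤ x² + y²`; no relation between the two families is needed. -/
lemma hasL1Bound_sum_mul_sum {Y : ι → Ω → ℝ} {Z : κ → Ω → ℝ} (hY : IsOrthogonalFamily Y 1 P)
    (hZ : IsOrthogonalFamily Z 1 P) {S : Finset ι} {T : Finset κ} {N : ℕ} (hS : S.card ≤ N)
    (hT : T.card ≤ N) : HasL1Bound P (fun ω => (∑ i ∈ S, Y i ω) * ∑ j ∈ T, Z j ω) N := by
  have i1 := (hY.memLp_sum S).integrable_sq
  have i2 := (hZ.memLp_sum T).integrable_sq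
  have i3 := (hY.memLp_sum S).integrable_mul (hZ.memLp_sum T)
  have hS' : (S.card : ℝ) ≤ N := by exact_mod_cast hS
  have hT' : (T.card : ℝ) ≤ N := by exact_mod_cast hT
  refine ⟨i3, ?_⟩
  calc ∫ ω, |(∑ i ∈ S, Y i ω) * ∑ j ∈ T, Z j ω| ∂P
      ≤ ∫ ω, (2⁻¹ * (∑ i ∈ S, Y i ω) ^ 2 + 2⁻¹ * (∑ j ∈ T, Z j ω) ^ 2) ∂P := by
        refine integral_mono i3.abs ((i1.const_mul _).add (i2.const_mul _)) fun ω => ?_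
        simp only
        rw [abs_le]
        constructor
        · nlinarith [sq_nonneg ((∑ i ∈ S, Y i ω) + ∑ j ∈ T, Z j ω)]
        · nlinarith [sq_nonneg ((∑ i ∈ S, Y i ω) - ∑ j ∈ T, Z j ω)]
    _ = 2⁻¹ * S.card + 2⁻¹ * T.card := by
        rw [integral_add (i1.const_mul _) (i2.const_mul _), integral_const_mul,
          integral_const_mul, hY.integral_sum_sq, hZ.integral_sum_sq, mul_one, mul_one]
    _ ≤ N := by linarith

end IsOrthogonalFamily

lemma empCov_eq {Ω : Type*} {X : ℕ → Ω → ℝ} (k : ℕ) (f g : ℝ → ℝ) (N : ℕ) (ω : Ω) :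
    empCov X k f g N ω = ((N : ℝ) - k)⁻¹ * (∑ i ∈ Finset.range (N - k), f (X i ω) * g (X (i + k) ω)
      - (N : ℝ)⁻¹ * ((∑ i ∈ Finset.range (N - k), f (X i ω)) * ∑ i ∈ Finset.range N, g (X i ω))
      - (N : ℝ)⁻¹ * ((∑ i ∈ Finset.range N, f (X i ω)) *
          ∑ i ∈ Finset.range (N - k), g (X (i + k) ω))
      + ((N - k : ℕ) : ℝ) * ((N : ℝ)⁻¹ ^ 2 * ((∑ i ∈ Finset.range N, f (X i ω)) *
          ∑ i ∈ Finset.range N, g (X i ω)))) := by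
  simp only [empCov, empMean, one_div, sub_mul, mul_sub, Finset.sum_sub_distrib, ← Finset.sum_mul,
    ← Finset.mul_sum, Finset.sum_const, Finset.card_range, nsmul_eq_mul]
  ring

namespace IsWhitened

variable {m : ℕ} {g : Fin m → ℝ → ℝ}

/-- Centring by the empirical means and truncating the sum does not matter asymptotically. -/
lemma hasL1Bound_remainder (hg : IsWhitened P X g) (hindep : iIndepFun X P)
    (hident : ∀ n, IdentDistrib (X n) (X 0) P P) {K : ℕ} (p : Fin K × (Fin m × Fin m)) {N : ℕ}
    (hN : 2 * K < N) :
    HasL1Bound P (fun ω => √N * empCov X (p.1 + 1) (g p.2.1) (g p.2.2) N ω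
      - (√N)⁻¹ * ∑ i ∈ Finset.range N, g p.2.1 (X i ω) * g p.2.2 (X (i + (p.1 + 1)) ω))
      ((K + √K + 5) * (√N)⁻¹) := by
  have := hindep.isProbabilityMeasure
  obtain ⟨l, a, b⟩ := p
  have hk : (l : ℕ) + 1 ≤ K := l.2
  dsimp only
  have ha := hg.isOrthogonalFamily hindep hident a
  have hb := hg.isOrthogonalFamily hindep hident b
  have hb' := hb.comp_injective (add_left_injective ((l : ℕ) + 1))
  have hW := (hg.isOrthogonalFamily_prod hindep hident K).comp_injective
    (e := fun i : ℕ => (i, (l, a, b))) fun i j h => (Prod.mk.inj h).1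
  dsimp only at hb' hW
  generalize (l : ℕ) + 1 = k at *
  have hNr : (0 : ℝ) < N := by exact_mod_cast (show 0 < N by omega)
  have hKr : (k : ℝ) ≤ K := by exact_mod_cast hk
  have hd : ((N - k : ℕ) : ℝ) = N - k := by
    push_cast [Nat.cast_sub (show k ≤ N by omega)]; rfl
  -- Source of the factor 2 in the bounds `c3`, used for two of the error terms.
  have hNk : (N : ℝ) ≤ 2 * (N - k) := by
    have : (2 * K : ℝ) < N := by exact_mod_cast hN
    linarith
  have hd0 : (0 : ℝ) < N - k := by linarith
  have hd1 : (1 : ℝ) ≤ N - k := by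
    rw [← hd]; exact_mod_cast (show 1 ≤ N - k by omega)
  have hs : √(N : ℝ) * √(N : ℝ) = N := Real.mul_self_sqrt hNr.le
  have hs0 : 0 < √(N : ℝ) := Real.sqrt_pos.2 hNr
  have hk0 : (0 : ℝ) ≤ k := k.cast_nonneg
  -- In units of `1/√N`, the errors are: `K` for normalising by `N - k` instead of `N`, `√K` for the
  -- `k` missing summands, 2 for each of the two mixed centring terms, and 1 for the product of the
  -- means.
  have b1 := (hW.hasL1Bound_sum (Finset.range (N - k))).const_mul
    (√N * ((N : ℝ) - k)⁻¹ - (√N)⁻¹)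
  have b2 := (hW.hasL1Bound_sum (Finset.range N \ Finset.range (N - k))).const_mul (-(√N)⁻¹)
  have b3 := (ha.hasL1Bound_sum_mul_sum hb (S := Finset.range (N - k)) (T := Finset.range N)
    (N := N) (by simp) (by simp)).const_mul (-(√N * ((N : ℝ) - k)⁻¹ * (N : ℝ)⁻¹))
  have b4 := (ha.hasL1Bound_sum_mul_sum hb' (S := Finset.range N) (T := Finset.range (N - k))
    (N := N) (by simp) (by simp)).const_mul (-(√N * ((N : ℝ) - k)⁻¹ * (N : ℝ)⁻¹))
  have b5 := (ha.hasL1Bound_sum_mul_sum hb (S := Finset.range N) (T := Finset.range N)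
    (N := N) (by simp) (by simp)).const_mul (√N * (N : ℝ)⁻¹ ^ 2)
  have hcoef : √N * ((N : ℝ) - k)⁻¹ ≤ 2 * (√N)⁻¹ := by
    rw [← div_eq_mul_inv, ← div_eq_mul_inv, div_le_div_iff₀ hd0 hs0, hs]
    exact hNk
  have hinvd : 0 < ((N : ℝ) - k)⁻¹ := inv_pos.2 hd0
  have hinvs : 0 < (√(N : ℝ))⁻¹ := inv_pos.2 hs0
  have c1 : |√N * ((N : ℝ) - k)⁻¹ - (√N)⁻¹| * √((Finset.range (N - k)).card : ℝ)
      ≤ K * (√N)⁻¹ := by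
    have e : √N * ((N : ℝ) - k)⁻¹ - (√N)⁻¹ = k * (√N)⁻¹ * ((N : ℝ) - k)⁻¹ := by
      field_simp
      rw [Real.sq_sqrt hNr.le]; ring
    rw [e, abs_of_nonneg (by positivity), Finset.card_range, hd, mul_assoc]
    have h1 : √((N : ℝ) - k) ≤ N - k := Real.sqrt_le_iff.2 ⟨hd0.le, by nlinarith⟩
    calc (k : ℝ) * (√N)⁻¹ * (((N : ℝ) - k)⁻¹ * √((N : ℝ) - k))
        ≤ k * (√N)⁻¹ * (((N : ℝ) - k)⁻¹ * (N - k)) := by gcongr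
      _ = k * (√N)⁻¹ := by rw [inv_mul_cancel₀ hd0.ne', mul_one]
      _ ≤ K * (√N)⁻¹ := by gcongr
  have c2 : |(-(√N)⁻¹)| * √((Finset.range N \ Finset.range (N - k)).card : ℝ) ≤ √K * (√N)⁻¹ := by
    rw [Finset.card_sdiff_of_subset (Finset.range_mono (Nat.sub_le _ _)), Finset.card_range,
      Finset.card_range, abs_neg, abs_of_pos hinvs, mul_comm,
      show N - (N - k) = k by omega]
    gcongr
  have c3 : |(-(√N * ((N : ℝ) - k)⁻¹ * (N : ℝ)⁻¹))| * N ≤ 2 * (√N)⁻¹ := by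
    rw [abs_neg, abs_of_pos (by positivity), inv_mul_cancel_right₀ hNr.ne']
    exact hcoef
  have c5 : |√N * (N : ℝ)⁻¹ ^ 2| * N ≤ (√N)⁻¹ := by
    rw [abs_of_pos (by positivity)]
    refine le_of_eq ?_
    field_simp
    rw [Real.sq_sqrt hNr.le]
  have hsum := ((((b1.mono c1).add (b2.mono c2)).add (b3.mono c3)).add (b4.mono c3)).add
    (b5.mono c5)
  convert! hsum.mono (d := (K + √K + 5) * (√N)⁻¹) (le_of_eq (by ring)) using 2 with ω
  rw [empCov_eq, hd, Finset.sum_sdiff_eq_sub (Finset.range_mono (Nat.sub_le _ _))]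
  have hdi : ((N : ℝ) - k)⁻¹ * (N - k) = 1 := inv_mul_cancel₀ hd0.ne'
  linear_combination (√N * (N : ℝ)⁻¹ ^ 2 * ((∑ i ∈ Finset.range N, g a (X i ω)) *
          ∑ i ∈ Finset.range N, g b (X i ω))) * hdi

/-- The joint central limit theorem for the empirical covariances of whitened functions. -/
theorem tendstoInDistribution_empCov [IsProbabilityMeasure P] (hg : IsWhitened P X g)
    (hindep : iIndepFun X P) (hident : ∀ n, IdentDistrib (X n) (X 0) P P) (K : ℕ) :
    TendstoInDistribution
      (fun (N : ℕ) ω => √N • (WithLp.toLp 2 fun p : Fin K × (Fin m × Fin m) =>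
        empCov X (p.1 + 1) (g p.2.1) (g p.2.2) N ω))
      atTop id (fun _ => P)
      (multivariateGaussian (0 : EuclideanSpace ℝ (Fin K × (Fin m × Fin m))) 1) := by
  have hX n := (hident n).aemeasurable_fst
  have hmeas (p : Fin K × (Fin m × Fin m)) (N : ℕ) :=
    aemeasurable_empCov hX (hg.measurable p.2.1) (hg.measurable p.2.2) (p.1 + 1) N
  have hV (N : ℕ) : AEMeasurable (fun ω => √(N : ℝ) • (WithLp.toLp 2
      fun p : Fin K × (Fin m × Fin m) => empCov X (p.1 + 1) (g p.2.1) (g p.2.2) N ω)) P := by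
    have : AEMeasurable (fun ω => WithLp.toLp 2
        fun p : Fin K × (Fin m × Fin m) => empCov X (p.1 + 1) (g p.2.1) (g p.2.2) N ω) P :=
      (WithLp.measurable_toLp 2 _).comp_aemeasurable (aemeasurable_pi_lambda _ fun p => hmeas p N)
    exact this.const_smul √(N : ℝ)
  refine ⟨hV, aemeasurable_id, ProbabilityMeasure.tendsto_iff_tendsto_charFun.2 fun t => ?_⟩
  simp only [ProbabilityMeasure.coe_mk, Measure.map_id, multivariateGaussian_zero_one,
    charFun_stdGaussian]
  -- The characteristic function at `t` only sees the linear combination with coefficients `t`.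
  have hlim := hg.tendsto_integral_exp hindep hident K t
  have hlim' : (Complex.exp ((-((∑ p, t p ^ 2) / 2) : ℝ) : ℂ))
      = Complex.exp (-(‖t‖ : ℂ) ^ 2 / 2) := by
    rw [← EuclideanSpace.real_norm_sq_eq]
    push_cast
    rw [neg_div]
  rw [hlim'] at hlim
  have hchar (N : ℕ) : charFun (P.map fun ω => √(N : ℝ) • (WithLp.toLp 2
      fun p : Fin K × (Fin m × Fin m) => empCov X (p.1 + 1) (g p.2.1) (g p.2.2) N ω)) t
      = ∫ ω, Complex.exp ((∑ p, t p * (√N * empCov X (p.1 + 1) (g p.2.1) (g p.2.2) N ω) : ℝ)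
          * Complex.I) ∂P := by
    rw [charFun_apply, integral_map (hV N) (AEMeasurable.aestronglyMeasurable (by fun_prop))]
    simp [PiLp.inner_apply]
  simp_rw [hchar]
  have hdiff : Tendsto (fun N : ℕ =>
      (∫ ω, Complex.exp ((∑ p, t p * (√N * empCov X (p.1 + 1) (g p.2.1) (g p.2.2) N ω) : ℝ)
          * Complex.I) ∂P) - ∫ ω, Complex.exp (((√N)⁻¹ * ∑ i ∈ Finset.range N, ∑ p, t p *
        (g p.2.1 (X i ω) * g p.2.2 (X (i + (p.1 + 1)) ω)) : ℝ) * Complex.I) ∂P) atTop (𝓝 0) := by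
    have hbound : Tendsto (fun N : ℕ =>
        ∑ p : Fin K × (Fin m × Fin m), |t p| * ((K + √K + 5) * (√N)⁻¹)) atTop (𝓝 0) := by
      have : Tendsto (fun N : ℕ => (√(N : ℝ))⁻¹) atTop (𝓝 0) :=
        tendsto_inv_atTop_zero.comp
          (Real.tendsto_sqrt_atTop.comp tendsto_natCast_atTop_atTop)
      have h2 := tendsto_finsetSum Finset.univ fun (p : Fin K × (Fin m × Fin m)) _ =>
        (this.const_mul ((K : ℝ) + √K + 5)).const_mul |t p|
      simpa using h2
    refine squeeze_zero_norm' ?_ hbound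
    filter_upwards [eventually_gt_atTop (2 * K)] with N hN
    have hR := HasL1Bound.sum (s := Finset.univ) fun (p : Fin K × (Fin m × Fin m)) _ =>
      (hg.hasL1Bound_remainder hindep hident p hN).const_mul (t p)
    have e (ω : Ω) : ∑ p : Fin K × (Fin m × Fin m), t p *
        (√N * empCov X (p.1 + 1) (g p.2.1) (g p.2.2) N ω
        - (√N)⁻¹ * ∑ i ∈ Finset.range N, g p.2.1 (X i ω) * g p.2.2 (X (i + (p.1 + 1)) ω))
        = ∑ p, t p * (√N * empCov X (p.1 + 1) (g p.2.1) (g p.2.2) N ω)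
          - (√N)⁻¹ * ∑ i ∈ Finset.range N, ∑ p, t p *
            (g p.2.1 (X i ω) * g p.2.2 (X (i + (p.1 + 1)) ω)) := by
      rw [Finset.sum_comm, Finset.mul_sum, ← Finset.sum_sub_distrib]
      refine Finset.sum_congr rfl fun p _ => ?_
      rw [← Finset.mul_sum]; ring
    simp_rw [e] at hR
    refine (norm_integral_exp_sub_le ?_ ?_ hR.1).trans hR.2
    · exact Finset.aemeasurable_fun_sum _ fun p _ => ((hmeas p N).const_mul _).const_mul _
    · refine (Finset.aemeasurable_fun_sum _ fun i _ => Finset.aemeasurable_fun_sum _ fun p _ =>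
        (AEMeasurable.mul ?_ ?_).const_mul _).const_mul _
      · exact (hg.measurable _).comp_aemeasurable (hX _)
      · exact (hg.measurable _).comp_aemeasurable (hX _)
  simpa using hdiff.add hlim

end IsWhitened

end IIDTest

end Remainder

/-! ### Reduction to whitened functions -/

section Whitening

open Topology

namespace IIDTest

section Algebra

variable {Ω : Type*} {X : ℕ → Ω → ℝ} {m : ℕ}

/-- The constants `μ` cancel because the empirical mean of a constant is that constant; this fails
for `N = 0`, where the mean is 0. -/
lemma sub_empMean_linearComb {ι : Type*} (s : Finset ι) (c μ : ι → ℝ) (f : ι → ℝ → ℝ) {N : ℕ}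
    (hN : N ≠ 0) (ω : Ω) (x : ℝ) :
    (∑ j ∈ s, c j * (f j x - μ j)) - empMean X (fun x => ∑ j ∈ s, c j * (f j x - μ j)) N ω
      = ∑ j ∈ s, c j * (f j x - empMean X (f j) N ω) := by
  have hNr : (N : ℝ) ≠ 0 := by exact_mod_cast hN
  have e : empMean X (fun x => ∑ j ∈ s, c j * (f j x - μ j)) N ω
      = ∑ j ∈ s, c j * (empMean X (f j) N ω - μ j) := by
    simp only [empMean]
    rw [Finset.sum_comm, Finset.mul_sum]
    refine Finset.sum_congr rfl fun j _ => ?_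
    rw [← Finset.mul_sum, Finset.sum_sub_distrib]
    simp only [Finset.sum_const, Finset.card_range, nsmul_eq_mul]
    field_simp
  rw [e, ← Finset.sum_sub_distrib]
  exact Finset.sum_congr rfl fun j _ => by ring

lemma empCov_linearComb {ι : Type*} (s : Finset ι) (c d μ : ι → ℝ) (f : ι → ℝ → ℝ) (k : ℕ) {N : ℕ}
    (hN : N ≠ 0) (ω : Ω) :
    empCov X k (fun x => ∑ j ∈ s, c j * (f j x - μ j)) (fun x => ∑ j ∈ s, d j * (f j x - μ j)) N ω
      = ∑ i ∈ s, ∑ j ∈ s, c i * d j * empCov X k (f i) (f j) N ω := by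
  simp only [empCov, sub_empMean_linearComb s _ μ f hN]
  simp_rw [Finset.sum_mul_sum, Finset.mul_sum]
  rw [Finset.sum_comm]
  refine Finset.sum_congr rfl fun i _ => ?_
  rw [Finset.sum_comm]
  refine Finset.sum_congr rfl fun j _ => Finset.sum_congr rfl fun n _ => ?_
  ring

lemma empCov_const_mul (c d : ℝ) (f g : ℝ → ℝ) (k N : ℕ) (ω : Ω) :
    empCov X k (fun x => c * f x) (fun x => d * g x) N ω = c * d * empCov X k f g N ω := by
  have e (c : ℝ) (f : ℝ → ℝ) : empMean X (fun x => c * f x) N ω = c * empMean X f N ω := by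
    simp only [empMean, ← Finset.mul_sum]; ring
  simp only [empCov, e, Finset.mul_sum]
  exact Finset.sum_congr rfl fun j _ => by ring

lemma smul_blockMul {K : ℕ} (E : Matrix (Fin m × Fin m) (Fin m × Fin m) ℝ)
    (v : Fin K → Fin m × Fin m → ℝ) (c : ℝ) : c • blockMul E v = blockMul E fun k => c • v k := by
  ext p
  simp [blockMul, Matrix.mulVec_smul]

lemma IsWhiteningMap.mul_mul_transpose {Φ : Matrix (Fin m) (Fin m) ℝ → Matrix (Fin m) (Fin m) ℝ}
    (hΦ : IsWhiteningMap Φ) {A : Matrix (Fin m) (Fin m) ℝ} (hA : A.PosDef) :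
    Φ A * A * (Φ A)ᵀ = 1 := by
  rw [mul_eq_one_comm, ← mul_assoc, hΦ.transpose_mul_self A hA]
  exact Matrix.nonsing_inv_mul A ((Matrix.isUnit_iff_isUnit_det A).1 hA.isUnit)

end Algebra

variable {Ω : Type*} [MeasurableSpace Ω] {P : Measure Ω} {X : ℕ → Ω → ℝ} {m : ℕ}

/-- A linear transformation which whitens the covariance matrix whitens the centred functions. -/
lemma isWhitened_linearComb [IsProbabilityMeasure P] {f : Fin m → ℝ → ℝ}
    (hf : ∀ i, Measurable (f i)) (hmem : ∀ i, MemLp (fun ω => f i (X 0 ω)) 2 P)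
    {A : Matrix (Fin m) (Fin m) ℝ} (hA : A * covMat P (X 0) f * Aᵀ = 1) :
    IsWhitened P X fun a x => ∑ j, A a j * (f j x - ∫ ω, f j (X 0 ω) ∂P) where
  measurable a := Finset.measurable_fun_sum _ fun j _ => ((hf j).sub_const _).const_mul _
  memLp a := memLp_finsetSum _ fun j _ => ((hmem j).sub (memLp_const _)).const_mul _
  integral_eq_zero a := by
    have hi (j : Fin m) := (hmem j).integrable one_le_two
    have hc (j : Fin m) : Integrable (fun ω => A a j * (f j (X 0 ω) - ∫ ω, f j (X 0 ω) ∂P)) P :=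
      ((hi j).sub (integrable_const _)).const_mul _
    rw [integral_finsetSum _ fun j _ => hc j]
    refine Finset.sum_eq_zero fun j _ => ?_
    rw [integral_const_mul, integral_sub (hi j) (integrable_const _)]
    simp
  integral_mul a b := by
    have hc (j : Fin m) : MemLp (fun ω => f j (X 0 ω) - ∫ ω, f j (X 0 ω) ∂P) 2 P :=
      (hmem j).sub (memLp_const _)
    have hint (i j : Fin m) : Integrable (fun ω => (A a i * A b j) *
        ((f i (X 0 ω) - ∫ ω, f i (X 0 ω) ∂P) * (f j (X 0 ω) - ∫ ω, f j (X 0 ω) ∂P))) P :=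
      ((hc i).integrable_mul (hc j)).const_mul _
    have e (ω : Ω) : (∑ j, A a j * (f j (X 0 ω) - ∫ ω, f j (X 0 ω) ∂P)) *
        (∑ j, A b j * (f j (X 0 ω) - ∫ ω, f j (X 0 ω) ∂P)) = ∑ i, ∑ j, (A a i * A b j) *
        ((f i (X 0 ω) - ∫ ω, f i (X 0 ω) ∂P) * (f j (X 0 ω) - ∫ ω, f j (X 0 ω) ∂P)) := by
      rw [Finset.sum_mul_sum]
      exact Finset.sum_congr rfl fun i _ => Finset.sum_congr rfl fun j _ => by ring
    simp_rw [e]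
    rw [integral_finsetSum _ fun i _ => integrable_finsetSum _ fun j _ => hint i j]
    simp_rw [integral_finsetSum _ fun j _ => hint _ j, integral_const_mul]
    have h := congrFun (congrFun hA a) b
    rw [Matrix.one_apply] at h
    rw [← h, Matrix.mul_apply]
    simp_rw [Matrix.mul_apply, Finset.sum_mul]
    rw [Finset.sum_comm]
    refine Finset.sum_congr rfl fun j _ => Finset.sum_congr rfl fun i _ => ?_
    simp only [covMat, covariance, Matrix.of_apply, Matrix.transpose_apply]
    ring

/-- The joint central limit theorem for linearly transformed empirical covariances. -/
theorem tendstoInDistribution_blockMul_empCovVec [IsProbabilityMeasure P]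
    (hindep : iIndepFun X P) (hident : ∀ n, IdentDistrib (X n) (X 0) P P) (K : ℕ)
    {f : Fin m → ℝ → ℝ} (hf : ∀ i, Measurable (f i))
    (hmem : ∀ i, MemLp (fun ω => f i (X 0 ω)) 2 P) {A : Matrix (Fin m) (Fin m) ℝ}
    (hA : A * covMat P (X 0) f * Aᵀ = 1) :
    TendstoInDistribution
      (fun (N : ℕ) ω => √(N : ℝ) • blockMul (A ⊗ₖ A)
        (fun k : Fin K => empCovVec X f ((k : ℕ) + 1) N ω))
      atTop id (fun _ => P)
      (multivariateGaussian (0 : EuclideanSpace ℝ (Fin K × (Fin m × Fin m))) 1) := by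
  have h := (isWhitened_linearComb hf hmem hA).tendstoInDistribution_empCov hindep hident K
  refine h.congr (fun N => ae_of_all _ fun ω => ?_) (ae_of_all _ fun _ => rfl)
  -- At `N = 0` the factor `√N` kills both sides.
  rcases eq_or_ne N 0 with rfl | hN
  · simp
  · dsimp only
    congr 1
    ext p
    simp only [blockMul]
    rw [empCov_linearComb Finset.univ (A p.2.1) (A p.2.2) _ f _ hN]
    simp [Matrix.mulVec, dotProduct, empCovVec, Fintype.sum_prod_type]

end IIDTest

end Whitening

/-! ### Correlations, by Slutsky's theorem -/

section Correlation

open Topology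

namespace IIDTest

variable {Ω : Type*} [MeasurableSpace Ω] {P : Measure Ω} {X : ℕ → Ω → ℝ} {m : ℕ}

lemma tendsto_empMean (hindep : iIndepFun X P) (hident : ∀ n, IdentDistrib (X n) (X 0) P P)
    {f : ℝ → ℝ} (hf : Measurable f) (hint : Integrable (fun ω => f (X 0 ω)) P) :
    ∀ᵐ ω ∂P, Tendsto (fun N : ℕ => empMean X f N ω) atTop (𝓝 (∫ ω, f (X 0 ω) ∂P)) := by
  have h := strong_law_ae_real (fun n ω => f (X n ω)) hint
    (fun i j hij => (hindep.indepFun hij).comp hf hf) fun n => (hident n).comp hf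
  simpa only [empMean, div_eq_inv_mul, mul_one] using h

/-- Strong consistency of the empirical standard deviation. -/
lemma tendsto_empStd (hindep : iIndepFun X P) (hident : ∀ n, IdentDistrib (X n) (X 0) P P)
    {f : ℝ → ℝ} (hf : Measurable f) (hmem : MemLp (fun ω => f (X 0 ω)) 2 P) :
    ∀ᵐ ω ∂P, Tendsto (fun N : ℕ => empStd X f N ω) atTop
      (𝓝 √Var[fun ω => f (X 0 ω); P]) := by
  have := hindep.isProbabilityMeasure
  filter_upwards [tendsto_empMean hindep hident hf (hmem.integrable one_le_two),
    tendsto_empMean hindep hident (hf.pow_const 2) hmem.integrable_sq] with ω h1 h2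
  have h3 := (h2.sub (h1.pow 2)).sqrt
  rw [variance_eq_sub hmem]
  refine Tendsto.congr (fun N => ?_) h3
  rcases eq_or_ne N 0 with rfl | hN
  · simp [empStd, empMean]
  · have hNr : (N : ℝ) ≠ 0 := by exact_mod_cast hN
    unfold empStd
    congr 1
    simp only [sub_sq, Finset.sum_add_distrib, Finset.sum_sub_distrib, ← Finset.sum_mul,
      ← Finset.mul_sum, Finset.sum_const, Finset.card_range, nsmul_eq_mul]
    simp only [empMean]
    field_simp
    ring

/-- Brings the correlation statement under the covariance theorem, applied to standardised
functions. -/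
lemma corrMat_eq_covMat (Y : Ω → ℝ) (f : Fin m → ℝ → ℝ) :
    corrMat P Y f = covMat P Y fun i x => (√Var[fun ω => f i (Y ω); P])⁻¹ * f i x := by
  ext i j
  simp only [corrMat, covMat, Matrix.of_apply, covariance_const_mul_left,
    covariance_const_mul_right]
  ring

lemma variance_pos_of_posDef_covMat {Y : Ω → ℝ} {f : Fin m → ℝ → ℝ}
    (hY : ∀ i, AEMeasurable (fun ω => f i (Y ω)) P) (h : (covMat P Y f).PosDef) (i : Fin m) :
    0 < Var[fun ω => f i (Y ω); P] := by
  have := h.diag_pos (i := i)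
  rwa [covMat, Matrix.of_apply, covariance_self (hY i)] at this

/-- The correlation matrix is congruent to the covariance matrix through the invertible diagonal
matrix of inverse standard deviations. -/
lemma posDef_corrMat {Y : Ω → ℝ} {f : Fin m → ℝ → ℝ}
    (hY : ∀ i, AEMeasurable (fun ω => f i (Y ω)) P) (h : (covMat P Y f).PosDef) :
    (corrMat P Y f).PosDef := by
  let U : Matrix (Fin m) (Fin m) ℝ :=
    Matrix.diagonal fun i => (√Var[fun ω => f i (Y ω); P])⁻¹
  have hU : IsUnit U := by
    refine Matrix.isUnit_diagonal.2 (Pi.isUnit_iff.2 fun i => ?_)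
    exact (inv_pos.2 (Real.sqrt_pos.2 (variance_pos_of_posDef_covMat hY h i))).ne'.isUnit
  have e : corrMat P Y f = star U * covMat P Y f * U := by
    ext i j
    simp only [U, Matrix.star_eq_conjTranspose, Matrix.diagonal_conjTranspose,
      Matrix.mul_diagonal, Matrix.diagonal_mul, corrMat, covMat, Matrix.of_apply]
    simp
    ring
  rw [e]
  exact hU.posDef_star_left_conjugate_iff.2 h

lemma continuous_blockMul {K : ℕ} (E : Matrix (Fin m × Fin m) (Fin m × Fin m) ℝ) :
    Continuous (blockMul (K := K) E) := by
  refine (PiLp.continuous_toLp 2 _).comp (continuous_pi fun p => ?_)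
  exact (continuous_apply p.2).comp ((Continuous.matrix_mulVec continuous_const
    (continuous_apply p.1)))

/-- Replacing the true standard deviations by the empirical ones. -/
theorem tendstoInDistribution_blockMul_empCorrVec [IsProbabilityMeasure P]
    (hindep : iIndepFun X P) (hident : ∀ n, IdentDistrib (X n) (X 0) P P) (K : ℕ)
    {f : Fin m → ℝ → ℝ} (hf : ∀ i, Measurable (f i))
    (hmem : ∀ i, MemLp (fun ω => f i (X 0 ω)) 2 P)
    (hvar : ∀ i, 0 < Var[fun ω => f i (X 0 ω); P]) {A : Matrix (Fin m) (Fin m) ℝ}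
    (hA : A * corrMat P (X 0) f * Aᵀ = 1) :
    TendstoInDistribution
      (fun (N : ℕ) ω => √(N : ℝ) • blockMul (A ⊗ₖ A)
        (fun k : Fin K => empCorrVec X f ((k : ℕ) + 1) N ω))
      atTop id (fun _ => P)
      (multivariateGaussian (0 : EuclideanSpace ℝ (Fin K × (Fin m × Fin m))) 1) := by
  have hX n := (hident n).aemeasurable_fst
  set s : Fin m → ℝ := fun i => √Var[fun ω => f i (X 0 ω); P]
  have hs0 (i : Fin m) : s i ≠ 0 := (Real.sqrt_pos.2 (hvar i)).ne'
  rw [corrMat_eq_covMat] at hA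
  have h1 := tendstoInDistribution_blockMul_empCovVec hindep hident K
    (fun i => (hf i).const_mul (s i)⁻¹) (fun i => (hmem i).const_mul (s i)⁻¹) hA
  set h : Fin m → ℝ → ℝ := fun i x => (s i)⁻¹ * f i x
  -- The random rescaling acts on coordinates before `A ⊗ A` is applied, so `A ⊗ A` has to be undone
  -- first.
  obtain ⟨B, hB⟩ : ∃ B, B * (A ⊗ₖ A) = 1 := by
    rw [mul_assoc, mul_eq_one_comm] at hA
    refine ⟨(covMat P (X 0) h * Aᵀ) ⊗ₖ (covMat P (X 0) h * Aᵀ), ?_⟩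
    rw [← Matrix.mul_kronecker_mul, hA, Matrix.one_kronecker_one]
  -- If an empirical standard deviation vanishes, division by zero makes both this ratio and the
  -- empirical correlation 0, so identity `e` below still holds.
  let r (N : ℕ) (ω : Ω) (q : Fin m × Fin m) : ℝ :=
    s q.1 * s q.2 / (empStd X (f q.1) N ω * empStd X (f q.2) N ω)
  have hr_meas (N : ℕ) : AEMeasurable (r N) P := by
    refine aemeasurable_pi_lambda _ fun q => AEMeasurable.const_div ?_ _
    exact (aemeasurable_empStd hX (hf _) N).mul (aemeasurable_empStd hX (hf _) N)
  have hr : TendstoInMeasure P r atTop fun _ _ => 1 := by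
    refine tendstoInMeasure_of_tendsto_ae (fun N => (hr_meas N).aestronglyMeasurable) ?_
    have hall : ∀ᵐ ω ∂P, ∀ i, Tendsto (fun N : ℕ => empStd X (f i) N ω) atTop (𝓝 (s i)) :=
      ae_all_iff.2 fun i => tendsto_empStd hindep hident (hf i) (hmem i)
    filter_upwards [hall] with ω hω
    refine tendsto_pi_nhds.2 fun q => ?_
    have hne := mul_ne_zero (hs0 q.1) (hs0 q.2)
    have := (tendsto_const_nhds (x := s q.1 * s q.2)).div ((hω q.1).mul (hω q.2)) hne
    rwa [div_self hne] at this
  -- The Slutsky map: undo `A ⊗ A`, rescale each coordinate, apply `A ⊗ A` again. When all ratios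
  -- are 1 it is the identity, so the limit law is unchanged.
  let G (z : EuclideanSpace ℝ (Fin K × (Fin m × Fin m)) × (Fin m × Fin m → ℝ)) :
      EuclideanSpace ℝ (Fin K × (Fin m × Fin m)) :=
    blockMul (A ⊗ₖ A) fun k q => z.2 q * (B *ᵥ fun q' => z.1 (k, q')) q
  have hG : Continuous G := by
    refine (continuous_blockMul _).comp (continuous_pi fun k => continuous_pi fun q => ?_)
    refine ((continuous_apply q).comp continuous_snd).mul ?_
    refine (continuous_apply q).comp (Continuous.matrix_mulVec continuous_const ?_)
    fun_prop
  have key := h1.continuous_comp_prodMk_of_tendstoInMeasure_const hG hr hr_meas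
  refine key.congr (fun N => ae_of_all _ fun ω => ?_) (ae_of_all _ fun u => ?_)
  · have e (k : Fin K) (q : Fin m × Fin m) :
        empCorrVec X f (k + 1) N ω q = r N ω q * empCovVec X h (k + 1) N ω q := by
      have h1 := hs0 q.1
      have h2 := hs0 q.2
      simp only [empCorrVec, empCorr, empCovVec, h, r, empCov_const_mul]
      field_simp
    simp only [G, smul_blockMul]
    congr 1
    funext k q
    simp only [blockMul, Matrix.mulVec_mulVec, Matrix.mulVec_smul]
    rw [hB, Matrix.one_mulVec]
    simp only [Pi.smul_apply, smul_eq_mul, e]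
    ring
  · ext p
    have hB' : (A ⊗ₖ A) * B = 1 := mul_eq_one_comm.1 hB
    simp [G, blockMul, Matrix.mulVec_mulVec, hB']

end IIDTest

end Correlation

theorem lemma4 {Ω : Type*} [MeasurableSpace Ω] (P : Measure Ω) [IsProbabilityMeasure P]
    (X : ℕ → Ω → ℝ) (hindep : iIndepFun X P) (hident : ∀ n, IdentDistrib (X n) (X 0) P P)
    (m K : ℕ) (f : Fin m → ℝ → ℝ) (hf : ∀ i, Measurable (f i))
    (hmom : ∀ i, Integrable (fun ω => f i (X 0 ω) ^ 4) P)
    (hpos : (IIDTest.covMat P (X 0) f).PosDef)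
    (Φ : Matrix (Fin m) (Fin m) ℝ → Matrix (Fin m) (Fin m) ℝ)
    (hΦ : IIDTest.IsWhiteningMap Φ) :
    TendstoInDistribution
      (fun (N : ℕ) ω => Real.sqrt (N : ℝ) •
        IIDTest.blockMul
          (Φ (IIDTest.covMat P (X 0) f) ⊗ₖ Φ (IIDTest.covMat P (X 0) f))
          (fun k : Fin K => IIDTest.empCovVec X f ((k : ℕ) + 1) N ω))
      atTop id (fun _ => P)
      (multivariateGaussian (0 : EuclideanSpace ℝ (Fin K × (Fin m × Fin m))) 1) ∧
    TendstoInDistribution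
      (fun (N : ℕ) ω => Real.sqrt (N : ℝ) •
        IIDTest.blockMul
          (Φ (IIDTest.corrMat P (X 0) f) ⊗ₖ Φ (IIDTest.corrMat P (X 0) f))
          (fun k : Fin K => IIDTest.empCorrVec X f ((k : ℕ) + 1) N ω))
      atTop id (fun _ => P)
      (multivariateGaussian (0 : EuclideanSpace ℝ (Fin K × (Fin m × Fin m))) 1) := by
  have hY (i : Fin m) : AEMeasurable (fun ω => f i (X 0 ω)) P :=
    (hf i).comp_aemeasurable (hident 0).aemeasurable_fst
  have hmem (i : Fin m) : MemLp (fun ω => f i (X 0 ω)) 2 P := by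
    refine (memLp_two_iff_integrable_sq (hY i).aestronglyMeasurable).2 ?_
    have h4 : MemLp (fun ω => f i (X 0 ω) ^ 2) 2 P := by
      refine (memLp_two_iff_integrable_sq ((hY i).pow_const 2).aestronglyMeasurable).2 ?_
      simpa only [← pow_mul] using hmom i
    exact h4.integrable one_le_two
  exact ⟨IIDTest.tendstoInDistribution_blockMul_empCovVec hindep hident K hf hmem
      (hΦ.mul_mul_transpose hpos),
    IIDTest.tendstoInDistribution_blockMul_empCorrVec hindep hident K hf hmem
      (IIDTest.variance_pos_of_posDef_covMat hY hpos)
      (hΦ.mul_mul_transpose (IIDTest.posDef_corrMat hY hpos))⟩
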